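/- Equip $\mathbb C^3$ with the Hermitian form $\langle v,w\rangle=v_0\overline{w_2}+v_1\overline{w_1}+v_2\overline{w_0}$ of signature $(2,1)$, and let $\mathrm{SU}(2,1)$ be the group of complex $3\times 3$ matrices of determinant $1$ preserving it. It acts on the complex hyperbolic plane $\mathbf H^2_{\mathbb C}$ (the set of complex lines in $\mathbb C^3$ that are negative for the form) and on its boundary $\partial\mathbf H^2_{\mathbb C}$ (the set of null lines). An element of $\mathrm{SU}(2,1)$ is called elliptic if it fixes a point of $\mathbf H^2_{\mathbb C}$, and parabolic if it fixes no point of $\mathbf H^2_{\mathbb C}$ and exactly one point of $\partial\mathbf H^2_{\mathbb C}$. Write $[g,h]=ghg^{-1}h^{-1}$. **Statement.** There are continuous maps $t\mapsto J_{1,t}$ and $t\mapsto J_{2,t}$ from $\mathbb R$ to $\mathrm{SU}(2,1)$ such that, with $A_t=J_{1,t}J_{2,t}$ and $B_t=J_{2,t}J_{1,t}$, the following hold. 1. For every $t$, $J_{1,t}$ and $J_{2,t}$ are elliptic of order $3$, and $J_{1,t}J_{2,t}$, $J_{1,t}J_{2,t}^{-1}$ and $[J_{1,t},J_{2,t}]$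 are parabolic. 2. For every $t$, the elements $A_t$, $B_t$, $A_tB_t$, $A_tB_t^{-1}$, $A_tB_t^2$, $A_t^2B_t$ and $[A_t,B_t]$ are all parabolic. 3. The groups $\langle A_t,B_t\rangle$ form a genuine one-parameter family: for $s\neq t$ no $g\in\mathrm{SU}(2,1)$ satisfies both $gA_sg^{-1}=A_t$ and $gB_sg^{-1}=B_t$; moreover, for each $s$, the set of $t$ for which the subgroup $\langle A_t,B_t\rangle$ is conjugate in $\mathrm{SU}(2,1)$ to $\langle A_s,B_s\rangle$ is at most countable. -/

import Mathlib

open scoped Matrix LinearAlgebra.Projectivization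

noncomputable section

namespace CxHyp

/-- The matrix of the Hermitian form of signature `(2,1)` on `ℂ³` given by
`⟨v, w⟩ = v₀ w̄₂ + v₁ w̄₁ + v₂ w̄₀`. -/
def formMatrix : Matrix (Fin 3) (Fin 3) ℂ :=
  !![0, 0, 1; 0, 1, 0; 1, 0, 0]

/-- The Hermitian form `⟨v, w⟩ = w* H v`. -/
def herm (v w : Fin 3 → ℂ) : ℂ :=
  star w ⬝ᵥ (formMatrix *ᵥ v)

/-- The group `SU(2,1)`: complex matrices of determinant one that preserve the Hermitian form. -/
def SU21 : Subgroup (Matrix.SpecialLinearGroup (Fin 3) ℂ) where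
  carrier := {g | (g : Matrix (Fin 3) (Fin 3) ℂ)ᴴ * formMatrix *
    (g : Matrix (Fin 3) (Fin 3) ℂ) = formMatrix}
  one_mem' := by simp
  mul_mem' := by
    intro a b ha hb
    simp only [Set.mem_ofPred_eq, Matrix.SpecialLinearGroup.coe_mul,
      Matrix.conjTranspose_mul] at ha hb ⊢
    calc (b : Matrix (Fin 3) (Fin 3) ℂ)ᴴ * (a : Matrix (Fin 3) (Fin 3) ℂ)ᴴ * formMatrix *
          ((a : Matrix (Fin 3) (Fin 3) ℂ) * (b : Matrix (Fin 3) (Fin 3) ℂ))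
        = (b : Matrix (Fin 3) (Fin 3) ℂ)ᴴ * ((a : Matrix (Fin 3) (Fin 3) ℂ)ᴴ * formMatrix *
          (a : Matrix (Fin 3) (Fin 3) ℂ)) * (b : Matrix (Fin 3) (Fin 3) ℂ) := by
          simp only [Matrix.mul_assoc]
      _ = formMatrix := by rw [ha, hb]
  inv_mem' := by
    intro a ha
    simp only [Set.mem_ofPred_eq] at ha ⊢
    have h1 : (a : Matrix (Fin 3) (Fin 3) ℂ) *
        ((a⁻¹ : Matrix.SpecialLinearGroup (Fin 3) ℂ) : Matrix (Fin 3) (Fin 3) ℂ) = 1 := by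
      rw [← Matrix.SpecialLinearGroup.coe_mul, mul_inv_cancel,
        Matrix.SpecialLinearGroup.coe_one]
    have h2 : ((a⁻¹ : Matrix.SpecialLinearGroup (Fin 3) ℂ) : Matrix (Fin 3) (Fin 3) ℂ)ᴴ *
        (a : Matrix (Fin 3) (Fin 3) ℂ)ᴴ = 1 := by
      rw [← Matrix.conjTranspose_mul, h1, Matrix.conjTranspose_one]
    generalize ((a⁻¹ : Matrix.SpecialLinearGroup (Fin 3) ℂ) : Matrix (Fin 3) (Fin 3) ℂ) = b
      at h1 h2 ⊢
    calc bᴴ * formMatrix * b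
        = bᴴ * ((a : Matrix (Fin 3) (Fin 3) ℂ)ᴴ * formMatrix *
          (a : Matrix (Fin 3) (Fin 3) ℂ)) * b := by rw [ha]
      _ = (bᴴ * (a : Matrix (Fin 3) (Fin 3) ℂ)ᴴ) * formMatrix *
          ((a : Matrix (Fin 3) (Fin 3) ℂ) * b) := by simp only [Matrix.mul_assoc]
      _ = formMatrix := by rw [h1, h2, Matrix.one_mul, Matrix.mul_one]

/-- The complex hyperbolic plane, as the set of negative lines in `ℂ³`. (The sign of `⟨v, v⟩`, a
real number, does not depend on the representative `v ≠ 0` of the line.) -/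
def hyperbolicPlane : Set (ℙ ℂ (Fin 3 → ℂ)) :=
  {p | (herm p.rep p.rep).re < 0}

/-- The boundary at infinity of the complex hyperbolic plane: the set of null lines in `ℂ³`. -/
def boundary : Set (ℙ ℂ (Fin 3 → ℂ)) :=
  {p | herm p.rep p.rep = 0}

/-- An element of `SU(2,1)` is elliptic if it fixes a point of the complex hyperbolic plane. -/
def IsElliptic (g : SU21) : Prop :=
  ∃ p ∈ hyperbolicPlane, (g : Matrix.SpecialLinearGroup (Fin 3) ℂ) • p = p

/-- An element of `SU(2,1)` is parabolic if it fixes no point of the complex hyperbolic plane and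
exactly one point of its boundary. -/
def IsParabolic (g : SU21) : Prop :=
  (∀ p ∈ hyperbolicPlane, (g : Matrix.SpecialLinearGroup (Fin 3) ℂ) • p ≠ p) ∧
    ∃! p, p ∈ boundary ∧ (g : Matrix.SpecialLinearGroup (Fin 3) ℂ) • p = p

/-- The subgroup `⟨A, B⟩` of `SU(2,1)` generated by two elements. -/
def gen (A B : SU21) : Subgroup SU21 :=
  Subgroup.closure {A, B}

end CxHyp

end

open scoped ComplexConjugate

namespace CxHyp

/-! The trace `τ` of an element of `SU(2,1)` determines its characteristic polynomial, `X³ - τX² +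
τ̄X - 1`. There is a unimodular double root `x` exactly when `τ = 2x + x̄²`, that is, when `τ` lies
on a deltoid. If moreover `x³ ≠ 1` and the Jordan block of `x` is nontrivial, the element is
parabolic (`hasJordanBlock_of_trace`, `HasJordanBlock.isParabolic`).

Since `J₁³ = J₂³ = 1`, each of the seven words in `A`, `B` is, up to conjugation and inversion, one
of `J₁J₂`, `[J₁,J₂]` and `(J₁J₂⁻¹)³` (`words_conjugate`). So only three elements have to be
controlled.

Take `J₁ = S` and `J₂ = T⁻¹`, where `S` and `T` have order three and both send the null line of `e₂`
to that of `e₀`. Then `J₁J₂` fixes the line of `e₀` and its trace is on the deltoid automatically.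
Put `u = |tr J₁J₂|²` and `v = |tr J₁J₂⁻¹|²`. Once `tr J₁J₂⁻¹` is on the deltoid too, the commutator
can be given a trace with real part `(u + v - 3)/2` and imaginary part `y`, where `4y² = 2uv - 27`.
Requiring that this trace be `2c + c̄²` with `c` unimodular and `q = 2 Re c + 1` amounts to `u + v =
q²` and `2uv - 27 = (3 - q)³(q + 1)`. These are solved for `q` in `(11/4, 3)`, which is the
parameter of the family.

Since `[J₁,J₂] = AB⁻¹` and the real part of its trace is `(q² - 3)/2`, distinct parameters give
non-conjugate pairs. A countable group contains only countably many pairs, which settles conjugacy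
of the subgroups (`countable_conj_gen`). -/

/-- The matrix of an element of `SU(2,1)`. -/
abbrev mat (g : SU21) : Matrix (Fin 3) (Fin 3) ℂ := g.1.1

theorem mat_one : mat 1 = 1 := rfl

theorem mat_mul (g h : SU21) : mat (g * h) = mat g * mat h := rfl

theorem mat_mul_inv (g : SU21) : mat g * mat g⁻¹ = 1 := by
  rw [← mat_mul, mul_inv_cancel, mat_one]

theorem mat_inv_mul (g : SU21) : mat g⁻¹ * mat g = 1 := by
  rw [← mat_mul, inv_mul_cancel, mat_one]

theorem mat_injective : Function.Injective mat := fun _ _ h => Subtype.ext (Subtype.ext h)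

theorem conjTranspose_mul_formMatrix_mul (g : SU21) :
    (mat g)ᴴ * formMatrix * mat g = formMatrix := g.2

theorem formMatrix_mul_self : formMatrix * formMatrix = 1 := by
  ext i j; fin_cases i <;> fin_cases j <;> simp [formMatrix, Matrix.mul_apply, Fin.sum_univ_three]

theorem mat_inv (g : SU21) : mat g⁻¹ = formMatrix * (mat g)ᴴ * formMatrix := by
  have h : formMatrix * (mat g)ᴴ * formMatrix * mat g = 1 := by
    rw [Matrix.mul_assoc formMatrix, Matrix.mul_assoc formMatrix,
      conjTranspose_mul_formMatrix_mul, formMatrix_mul_self]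
  calc mat g⁻¹ = formMatrix * (mat g)ᴴ * formMatrix * mat g * mat g⁻¹ := by rw [h, one_mul]
    _ = _ := by rw [Matrix.mul_assoc _ (mat g), mat_mul_inv, mul_one]

/-! ### The Hermitian form and fixed points in the projective plane -/

theorem herm_apply (v w : Fin 3 → ℂ) :
    herm v w = conj (w 0) * v 2 + conj (w 1) * v 1 + conj (w 2) * v 0 := by
  simp [herm, formMatrix, Matrix.mulVec, dotProduct, Fin.sum_univ_three]

theorem herm_mulVec (g : SU21) (v w : Fin 3 → ℂ) :
    herm (mat g *ᵥ v) (mat g *ᵥ w) = herm v w := by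
  unfold herm
  rw [Matrix.star_mulVec, ← Matrix.dotProduct_mulVec, Matrix.mulVec_mulVec, Matrix.mulVec_mulVec,
    conjTranspose_mul_formMatrix_mul]

theorem herm_smul_left (c : ℂ) (v w : Fin 3 → ℂ) : herm (c • v) w = c * herm v w := by
  simp [herm_apply]; ring

theorem herm_smul_right (c : ℂ) (v w : Fin 3 → ℂ) : herm v (c • w) = conj c * herm v w := by
  simp [herm_apply]; ring

theorem herm_sub_left (v v' w : Fin 3 → ℂ) : herm (v - v') w = herm v w - herm v' w := by
  simp [herm_apply]; ring

theorem conj_herm (v w : Fin 3 → ℂ) : conj (herm v w) = herm w v := by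
  simp [herm_apply]; ring

/-- On the orthogonal complement of a null vector `v` the form is positive semidefinite with radical
spanned by `v`: after subtracting a multiple of `v` from `x`, only one squared modulus is left. -/
theorem herm_orthogonal_null {v x : Fin 3 → ℂ} (hv : v ≠ 0) (hvv : herm v v = 0)
    (hx : herm x v = 0) :
    0 ≤ (herm x x).re ∧ (herm x x = 0 → ∃ c : ℂ, x = c • v) := by
  rw [herm_apply] at hvv hx
  by_cases h2 : v 2 = 0
  · have h1 : v 1 = 0 := by simpa [h2] using hvv
    have h0 : v 0 ≠ 0 := fun h0 => hv (by ext i; fin_cases i <;> simp [h0, h1, h2])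
    have hx2 : x 2 = 0 := by simpa [h1, h2, h0] using hx
    have e : herm x x = (Complex.normSq (x 1) : ℂ) := by
      rw [herm_apply, hx2, ← Complex.mul_conj]; simp; ring
    rw [e]
    refine ⟨by simpa using Complex.normSq_nonneg _, fun h => ⟨x 0 / v 0, ?_⟩⟩
    have hx1 : x 1 = 0 := by simpa using h
    ext i; fin_cases i <;> simp [h0, h1, h2, hx1, hx2]
  · have h2' : conj (v 2) ≠ 0 := by simpa using h2
    set c := x 2 / v 2 with hc
    have hc2 : x 2 = c * v 2 := by rw [hc]; field_simp
    have hx' := congrArg conj hx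
    simp only [map_add, map_mul, Complex.conj_conj, map_zero] at hx'
    have e : herm x x = (Complex.normSq (x 1 - c * v 1) : ℂ) := by
      rw [herm_apply, ← Complex.mul_conj, map_sub, map_mul, hc2, map_mul]
      rw [hc2] at hx hx'
      simp only [map_mul] at hx hx'
      linear_combination conj c * hx + c * hx' - c * conj c * hvv
    rw [e]
    refine ⟨by simpa using Complex.normSq_nonneg _, fun h => ⟨c, ?_⟩⟩
    have hx1 : x 1 = c * v 1 := by
      have : x 1 - c * v 1 = 0 := by simpa using h
      linear_combination this
    have hx0 : x 0 = c * v 0 := by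
      rw [hc2, hx1] at hx
      apply mul_left_cancel₀ h2'
      linear_combination hx - c * hvv
    ext i; fin_cases i <;> simp [hx0, hx1, hc2]

theorem smul_eq_self_iff (g : SU21) (p : ℙ ℂ (Fin 3 → ℂ)) :
    (g : Matrix.SpecialLinearGroup (Fin 3) ℂ) • p = p ↔ ∃ c : ℂ, mat g *ᵥ p.rep = c • p.rep := by
  conv_lhs => rw [← p.mk_rep, Projectivization.smul_mk, Projectivization.mk_eq_mk_iff']
  constructor
  · rintro ⟨c, hc⟩; exact ⟨c, hc.symm⟩
  · rintro ⟨c, hc⟩; exact ⟨c, hc.symm⟩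

theorem exists_rep_mk (v : Fin 3 → ℂ) (hv : v ≠ 0) :
    ∃ c : ℂ, c ≠ 0 ∧ (Projectivization.mk ℂ v hv).rep = c • v := by
  obtain ⟨a, ha⟩ := Projectivization.exists_smul_eq_mk_rep ℂ v hv
  exact ⟨a, a.ne_zero, ha.symm⟩

theorem isElliptic_of_eigenvector {g : SU21} {v : Fin 3 → ℂ} {c : ℂ} (hg : mat g *ᵥ v = c • v)
    (hv : (herm v v).re < 0) : IsElliptic g := by
  have hv0 : v ≠ 0 := by rintro rfl; simp [herm] at hv
  obtain ⟨d, hd, hrep⟩ := exists_rep_mk v hv0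
  refine ⟨Projectivization.mk ℂ v hv0, ?_, (smul_eq_self_iff _ _).2 ⟨c, ?_⟩⟩
  · have e : herm (d • v) (d • v) = (Complex.normSq d : ℂ) * herm v v := by
      rw [herm_smul_left, herm_smul_right, ← Complex.mul_conj]; ring
    simp only [hyperbolicPlane, Set.mem_ofPred_eq, hrep, e, Complex.re_ofReal_mul]
    exact mul_neg_of_pos_of_neg (Complex.normSq_pos.2 hd) hv
  · rw [hrep, Matrix.mulVec_smul, hg, smul_comm]

/-! ### Jordan blocks and parabolic elements -/

/-- The matrix `M` has unimodular eigenvalues `x ≠ y`, and a Jordan block of size two for `x`. -/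
structure HasJordanBlock (M : Matrix (Fin 3) (Fin 3) ℂ) (x y : ℂ) : Prop where
  unit_left : x * conj x = 1
  unit_right : y * conj y = 1
  ne : x ≠ y
  annihilates : (M - x • 1) * ((M - x • 1) * (M - y • 1)) = 0
  ne_zero : (M - x • 1) * (M - y • 1) ≠ 0

theorem sub_smul_one_mulVec (M : Matrix (Fin 3) (Fin 3) ℂ) (x : ℂ) (v : Fin 3 → ℂ) :
    (M - x • 1) *ᵥ v = M *ᵥ v - x • v := by
  rw [Matrix.sub_mulVec, Matrix.smul_mulVec, Matrix.one_mulVec]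

theorem herm_mulVec_of_eigenvector {g : SU21} {v : Fin 3 → ℂ} {x : ℂ} (hx : x * conj x = 1)
    (hv : mat g *ᵥ v = x • v) (w : Fin 3 → ℂ) : herm (mat g *ᵥ w) v = x * herm w v := by
  have h := herm_mulVec g w v
  rw [hv, herm_smul_right] at h
  linear_combination x * h - herm (mat g *ᵥ w) v * hx

/-- A nonzero vector `v` in the image of `(g - x)(g - y)` is an `x`-eigenvector lying in the image
of `g - x`. By unitarity it is orthogonal to every eigenvector of `g`, itself included. So `v` is
null, and `herm_orthogonal_null` leaves no negative eigenvector and no other null one. -/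
theorem HasJordanBlock.isParabolic {g : SU21} {x y : ℂ} (h : HasJordanBlock (mat g) x y) :
    IsParabolic g := by
  obtain ⟨hx, hy, hne, hann, hN⟩ := h
  obtain ⟨w, hw⟩ : ∃ w, ((mat g - x • 1) * (mat g - y • 1)) *ᵥ w ≠ 0 := by
    by_contra! hcon
    exact hN (Matrix.ext_of_mulVec_single fun i => by rw [hcon, Matrix.zero_mulVec])
  set v := ((mat g - x • 1) * (mat g - y • 1)) *ᵥ w with hv
  have hgv : mat g *ᵥ v = x • v := by
    have : (mat g - x • 1) *ᵥ v = 0 := by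
      rw [hv, Matrix.mulVec_mulVec, hann, Matrix.zero_mulVec]
    rwa [sub_smul_one_mulVec, sub_eq_zero] at this
  have hv' : v = mat g *ᵥ ((mat g - y • 1) *ᵥ w) - x • ((mat g - y • 1) *ᵥ w) := by
    rw [← sub_smul_one_mulVec, Matrix.mulVec_mulVec]
  have orth : ∀ u, mat g *ᵥ u = x • u → herm u v = 0 := by
    intro u hu
    rw [← conj_herm, hv', herm_sub_left, herm_mulVec_of_eigenvector hx hu, herm_smul_left,
      sub_self, map_zero]
  have eig : ∀ u : Fin 3 → ℂ, u ≠ 0 → ∀ c : ℂ, mat g *ᵥ u = c • u → herm u v = 0 := by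
    intro u hu0 c hu
    have h0 : ∀ z : ℂ, (mat g - z • 1) *ᵥ u = (c - z) • u := fun z => by
      rw [sub_smul_one_mulVec, hu, sub_smul]
    have h1 : ((c - y) * ((c - x) * (c - x))) • u = 0 := by
      have := congrArg (· *ᵥ u) hann
      simpa only [← Matrix.mulVec_mulVec, h0, Matrix.mulVec_smul, smul_smul,
        Matrix.zero_mulVec, mul_assoc] using this
    rcases smul_eq_zero.1 h1 with h1 | h1
    · rcases mul_eq_zero.1 h1 with h2 | h2
      · have hcy : c = y := by linear_combination h2
        have e := herm_mulVec_of_eigenvector hx hgv u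
        rw [hu, hcy, herm_smul_left] at e
        have : (y - x) * herm u v = 0 := by linear_combination e
        rcases mul_eq_zero.1 this with h3 | h3
        · exact absurd (by linear_combination -h3) hne
        · exact h3
      · have hcx : c = x := by
          have := mul_self_eq_zero.1 h2
          linear_combination this
        exact orth u (hcx ▸ hu)
    · exact absurd h1 hu0
  have hvv : herm v v = 0 := orth v hgv
  have key : ∀ p : ℙ ℂ (Fin 3 → ℂ), (g : Matrix.SpecialLinearGroup (Fin 3) ℂ) • p = p →
      0 ≤ (herm p.rep p.rep).re ∧ (herm p.rep p.rep = 0 → ∃ c : ℂ, p.rep = c • v) := by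
    intro p hp
    obtain ⟨c, hc⟩ := (smul_eq_self_iff g p).1 hp
    exact herm_orthogonal_null hw hvv (eig _ p.rep_nonzero c hc)
  obtain ⟨d, hd, hrep⟩ := exists_rep_mk v hw
  refine ⟨fun p hp hgp => not_lt.2 (key p hgp).1 hp,
    Projectivization.mk ℂ v hw, ⟨?_, (smul_eq_self_iff _ _).2 ⟨x, ?_⟩⟩, ?_⟩
  · simp [boundary, hrep, herm_smul_left, herm_smul_right, hvv]
  · rw [hrep, Matrix.mulVec_smul, hgv, smul_comm]
  · rintro p ⟨hp, hgp⟩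
    obtain ⟨c, hc⟩ := (key p hgp).2 hp
    rw [← p.mk_rep, Projectivization.mk_eq_mk_iff']
    exact ⟨c, hc.symm⟩

theorem HasJordanBlock.conj {g : SU21} {x y : ℂ} (h : HasJordanBlock (mat g) x y) (k : SU21) :
    HasJordanBlock (mat (k * g * k⁻¹)) x y := by
  have e : ∀ z : ℂ, mat (k * g * k⁻¹) - z • 1 = mat k * (mat g - z • 1) * mat k⁻¹ := fun z => by
    rw [mat_mul, mat_mul, mul_sub, sub_mul, mul_smul_comm, smul_mul_assoc, mul_one, mat_mul_inv]
  have e2 : ∀ P Q : Matrix (Fin 3) (Fin 3) ℂ,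
      mat k * P * mat k⁻¹ * (mat k * Q * mat k⁻¹) = mat k * (P * Q) * mat k⁻¹ := fun P Q => by
    calc _ = mat k * P * (mat k⁻¹ * mat k) * Q * mat k⁻¹ := by simp only [mul_assoc]
      _ = _ := by rw [mat_inv_mul]; simp only [mul_assoc, mul_one]
  obtain ⟨hx, hy, hne, hann, hN⟩ := h
  refine ⟨hx, hy, hne, ?_, fun h0 => hN ?_⟩
  · rw [e, e, e2, e2, hann, mul_zero, zero_mul]
  · rw [e, e, e2] at h0
    generalize (mat g - x • 1) * (mat g - y • 1) = N at h0 ⊢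
    calc N = (mat k⁻¹ * mat k) * N * (mat k⁻¹ * mat k) := by rw [mat_inv_mul, one_mul, mul_one]
      _ = mat k⁻¹ * (mat k * N * mat k⁻¹) * mat k := by simp only [mul_assoc]
      _ = 0 := by rw [h0, mul_zero, zero_mul]

theorem HasJordanBlock.inv {g : SU21} {x y : ℂ} (h : HasJordanBlock (mat g) x y) :
    HasJordanBlock (mat g⁻¹) (conj x) (conj y) := by
  obtain ⟨hx, hy, hne, hann, hN⟩ := h
  have e : ∀ z : ℂ, z * conj z = 1 →
      mat g⁻¹ - conj z • 1 = (-conj z) • (mat g⁻¹ * (mat g - z • 1)) := fun z hz => by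
    rw [mul_sub, mat_inv_mul, mul_smul_comm, mul_one, smul_sub, smul_smul, neg_mul,
      mul_comm (conj z), hz]
    simp only [neg_smul, one_smul]; abel
  have comm : ∀ z : ℂ, Commute (mat g⁻¹) (mat g - z • 1) := fun z =>
    (show Commute (mat g⁻¹) (mat g) by
      rw [commute_iff_eq, mat_inv_mul, mat_mul_inv]).sub_right
      ((Commute.one_right _).smul_right z)
  have e2 : mat g⁻¹ * (mat g - x • 1) * (mat g⁻¹ * (mat g - y • 1)) =
      mat g⁻¹ * mat g⁻¹ * ((mat g - x • 1) * (mat g - y • 1)) := by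
    calc _ = mat g⁻¹ * ((mat g - x • 1) * mat g⁻¹) * (mat g - y • 1) := by simp only [mul_assoc]
      _ = _ := by rw [← (comm x).eq]; simp only [mul_assoc]
  have hx0 : conj x ≠ 0 := right_ne_zero_of_mul_eq_one hx
  have hy0 : conj y ≠ 0 := right_ne_zero_of_mul_eq_one hy
  refine ⟨by rw [Complex.conj_conj, mul_comm, hx], by rw [Complex.conj_conj, mul_comm, hy],
    fun h0 => hne ((starRingEnd ℂ).injective h0), ?_, fun h0 => hN ?_⟩
  · rw [e x hx, e y hy]
    simp only [smul_mul_assoc, mul_smul_comm, e2]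
    have : mat g⁻¹ * (mat g - x • 1) * (mat g⁻¹ * mat g⁻¹ *
        ((mat g - x • 1) * (mat g - y • 1))) = 0 := by
      rw [show mat g⁻¹ * (mat g - x • 1) * (mat g⁻¹ * mat g⁻¹ *
        ((mat g - x • 1) * (mat g - y • 1))) = mat g⁻¹ * ((mat g - x • 1) * (mat g⁻¹ * mat g⁻¹)) *
        ((mat g - x • 1) * (mat g - y • 1)) by simp only [mul_assoc],
        ← ((comm x).mul_left (comm x)).eq, mul_assoc, mul_assoc (mat g⁻¹ * mat g⁻¹), hann,
        mul_zero, mul_zero]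
    rw [this, smul_zero, smul_zero, smul_zero]
  · rw [e x hx, e y hy] at h0
    simp only [smul_mul_assoc, mul_smul_comm, e2, smul_smul] at h0
    have h1 := (smul_eq_zero.1 h0).resolve_left
      (mul_ne_zero (neg_ne_zero.2 hy0) (neg_ne_zero.2 hx0))
    generalize (mat g - x • 1) * (mat g - y • 1) = N at h1 ⊢
    calc N = mat g * (mat g * mat g⁻¹) * mat g⁻¹ * N := by
          rw [mat_mul_inv, mul_one, mat_mul_inv, one_mul]
      _ = mat g * mat g * (mat g⁻¹ * mat g⁻¹ * N) := by simp only [mul_assoc]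
      _ = 0 := by rw [h1, mul_zero]

/-- Needed because `[A,B]` is the cube of `J₁J₂⁻¹`. Write `M³ - z³ = (M² + zM + z²)(M - z)`; on the
image of `(M - x)(M - y)` the quadratic factors act as the scalars `3x²` and `x² + xy + y²`, both
nonzero. -/
theorem HasJordanBlock.cube {M : Matrix (Fin 3) (Fin 3) ℂ} {x y : ℂ} (h : HasJordanBlock M x y)
    (hxy : x ^ 3 ≠ y ^ 3) : HasJordanBlock (M ^ 3) (x ^ 3) (y ^ 3) := by
  obtain ⟨hx, hy, hne, hann, hN⟩ := h
  set q : ℂ → Matrix (Fin 3) (Fin 3) ℂ := fun z => M ^ 2 + z • M + z ^ 2 • 1 with hq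
  have e : ∀ z : ℂ, M ^ 3 - z ^ 3 • 1 = q z * (M - z • 1) := fun z => by
    simp only [hq, add_mul, mul_sub, smul_mul_assoc, mul_smul_comm, mul_one, one_mul, pow_succ,
      pow_zero]
    module
  have comm : ∀ z t : ℂ, Commute (M - z • 1) (q t) := fun z t => by
    have hM : Commute (M - z • 1) M :=
      (Commute.refl M).sub_left ((Commute.one_left M).smul_left z)
    exact ((hM.pow_right 2).add_right (hM.smul_right t)).add_right
      ((Commute.one_right _).smul_right _)
  set N := (M - x • 1) * (M - y • 1) with hNdef
  have hMN : M * N = x • N := by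
    rw [sub_mul, sub_eq_zero] at hann
    simpa using hann
  have hqN : ∀ z, q z * N = (x ^ 2 + z * x + z ^ 2) • N := fun z => by
    simp only [hq, add_mul, pow_two, smul_mul_assoc, one_mul, mul_assoc, hMN, mul_smul_comm,
      smul_smul]
    module
  have e2 : (M ^ 3 - x ^ 3 • 1) * (M ^ 3 - y ^ 3 • 1) =
      ((x ^ 2 + x * x + x ^ 2) * (x ^ 2 + y * x + y ^ 2)) • N := by
    calc (M ^ 3 - x ^ 3 • 1) * (M ^ 3 - y ^ 3 • 1)
        = q x * ((M - x • 1) * q y) * (M - y • 1) := by rw [e, e]; simp only [mul_assoc]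
      _ = q x * (q y * N) := by rw [(comm x y).eq, hNdef]; simp only [mul_assoc]
      _ = _ := by rw [hqN, mul_smul_comm, hqN, smul_smul, mul_comm]
  have hx0 : x ≠ 0 := left_ne_zero_of_mul_eq_one hx
  refine ⟨by rw [map_pow, ← mul_pow, hx, one_pow], by rw [map_pow, ← mul_pow, hy, one_pow],
    hxy, ?_, ?_⟩
  · rw [e2, mul_smul_comm, e, mul_assoc, hann, mul_zero, smul_zero]
  · rw [e2]
    refine smul_ne_zero (mul_ne_zero ?_ fun h0 => hxy ?_) hN
    · rw [show x ^ 2 + x * x + x ^ 2 = 3 * x ^ 2 by ring]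
      exact mul_ne_zero three_ne_zero (pow_ne_zero 2 hx0)
    · linear_combination (x - y) * h0

/-! ### Detecting a Jordan block from the trace -/

theorem adjugate_fin_three_eq (M : Matrix (Fin 3) (Fin 3) ℂ) :
    M.adjugate = M * M - M.trace • M + M.adjugate.trace • 1 := by
  rw [Matrix.adjugate_fin_three]
  ext i j
  fin_cases i <;> fin_cases j <;>
    simp [Matrix.mul_apply, Fin.sum_univ_three, Matrix.trace_fin_three] <;> ring

theorem trace_adjugate_sub_smul_one (M : Matrix (Fin 3) (Fin 3) ℂ) (x : ℂ) :
    (M - x • 1).adjugate.trace = M.adjugate.trace - 2 * x * M.trace + 3 * x ^ 2 := by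
  rw [Matrix.adjugate_fin_three, Matrix.adjugate_fin_three]
  simp [Matrix.trace_fin_three]
  ring

theorem det_sub_smul_one (M : Matrix (Fin 3) (Fin 3) ℂ) (x : ℂ) :
    (M - x • 1).det = M.det - x * M.adjugate.trace + x ^ 2 * M.trace - x ^ 3 := by
  rw [Matrix.adjugate_fin_three, Matrix.det_fin_three, Matrix.det_fin_three]
  simp [Matrix.trace_fin_three]
  ring

/-- An element of `SU(2,1)` whose trace lies on the deltoid, and which is not a complex
reflection, has a Jordan block of size two. -/
theorem hasJordanBlock_of_trace {g : SU21} {x : ℂ} (hx : x * conj x = 1) (hx3 : x ^ 3 ≠ 1)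
    (htr : (mat g).trace = 2 * x + conj x ^ 2)
    (hminor : mat g 0 1 * mat g 1 2 - mat g 0 2 * (mat g 1 1 - x) ≠ 0) :
    HasJordanBlock (mat g) x (conj x ^ 2) := by
  -- By unitarity the inverse is conjugate to the conjugate transpose, so the linear coefficient of
  -- the characteristic polynomial is the conjugate of the trace.
  have hadj : (mat g).adjugate.trace = conj (mat g).trace := by
    have h1 : (mat g).adjugate = mat g⁻¹ := rfl
    rw [h1, mat_inv, Matrix.mul_assoc, Matrix.trace_mul_comm, Matrix.mul_assoc,
      formMatrix_mul_self, mul_one, Matrix.trace_conjTranspose]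
    rfl
  have hdet : (mat g).det = 1 := g.1.2
  rw [htr] at hadj
  simp only [map_add, map_mul, map_pow, Complex.conj_conj, Complex.conj_ofNat] at hadj
  refine ⟨hx, ?_, fun h => hx3 ?_, ?_, ?_⟩
  · rw [map_pow, Complex.conj_conj, ← mul_pow, mul_comm, hx, one_pow]
  · linear_combination x ^ 2 * h + (x * conj x + 1) * hx
  all_goals
    generalize mat g = M at *
    generalize conj x = x' at *
    -- With `N = M - x`, the identity `adj N = N² - (tr N) N + tr (adj N)` loses its last term
    -- because `x` is a double root. Hence the product is `adj N`, and `hminor` is its entry `(0,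
    -- 2)`.
    have hN : (M - x • 1) * (M - x' ^ 2 • 1) = (M - x • 1).adjugate := by
      have ht : (M - x • 1).trace = x' ^ 2 - x := by
        rw [Matrix.trace_sub, htr, Matrix.trace_smul, Matrix.trace_one]
        simp; ring
      have ht' : (M - x • 1).adjugate.trace = 0 := by
        rw [trace_adjugate_sub_smul_one, hadj, htr]
        linear_combination -2 * x' * hx
      rw [adjugate_fin_three_eq, ht, ht', zero_smul, add_zero]
      simp only [mul_sub, sub_mul, mul_smul_comm, smul_mul_assoc, mul_one, one_mul]
      module
    rw [hN]
  · rw [Matrix.mul_adjugate, det_sub_smul_one, hdet, hadj, htr]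
    rw [show 1 - x * (2 * x' + x ^ 2) + x ^ 2 * (2 * x + x' ^ 2) - x ^ 3 = 0 by
      linear_combination (x * x' - 1) * hx, zero_smul]
  · intro h0
    apply hminor
    have := congrFun (congrFun h0 0) 2
    rw [Matrix.adjugate_fin_three] at this
    simpa using this

/-! ### Elliptic elements of order three -/

/-- The elements of order three of `SU(2,1)` that map `e₂` to `a • e₀`. -/
def rot (a z : ℂ) (ha : a * conj a = 1) (hz : z * conj z = -(a ^ 3 + conj a ^ 3)) : SU21 :=
  ⟨⟨!![conj a ^ 2, conj z, a; z * conj a, -conj a ^ 2, 0; a, 0, 0], by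
    rw [Matrix.det_fin_three]
    simp
    linear_combination (a * conj a + 1) * ha⟩, by
    change !![conj a ^ 2, conj z, a; z * conj a, -conj a ^ 2, 0; a, 0, 0]ᴴ * formMatrix *
      !![conj a ^ 2, conj z, a; z * conj a, -conj a ^ 2, 0; a, 0, 0] = formMatrix
    ext i j
    fin_cases i <;> fin_cases j <;>
      simp [formMatrix, Matrix.mul_apply, Fin.sum_univ_three, Matrix.conjTranspose_apply]
    all_goals first
      | linear_combination ha
      | linear_combination (a * conj a + 1) * ha
      | linear_combination a * conj a * hz - (a ^ 3 + conj a ^ 3) * ha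
      | linear_combination hz
      | linear_combination -conj z * conj a * ha
      | linear_combination -z * a * ha⟩

section rot

variable {a z : ℂ} (ha : a * conj a = 1) (hz : z * conj z = -(a ^ 3 + conj a ^ 3))

theorem mat_rot : mat (rot a z ha hz) =
    !![conj a ^ 2, conj z, a; z * conj a, -conj a ^ 2, 0; a, 0, 0] := rfl

theorem rot_cube : rot a z ha hz ^ 3 = 1 := by
  have h : conj a ^ 4 + z * conj z * conj a + a ^ 2 = 0 := by
    linear_combination conj a * hz - a ^ 2 * ha
  apply mat_injective
  rw [pow_succ, pow_two, mat_mul, mat_mul, mat_one, mat_rot]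
  ext i j
  fin_cases i <;> fin_cases j <;> simp [Matrix.mul_apply, Fin.sum_univ_three]
  · linear_combination conj a ^ 2 * h + (a * conj a + 1) * ha
  · linear_combination conj z * h
  · left; linear_combination h
  · linear_combination z * conj a * h
  · linear_combination -conj a ^ 2 * h + (a * conj a + 1) * ha
  · left; ring
  · linear_combination a * h
  · ring
  · linear_combination (a * conj a + 1) * ha

theorem orderOf_rot : orderOf (rot a z ha hz) = 3 := by
  refine orderOf_eq_prime (rot_cube ha hz) fun h => ?_
  have := congrFun (congrFun (congrArg mat h) 2) 2
  simp [mat_rot, mat_one] at this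

/-- The products of `a` with the three cube roots of unity sum to zero, so if no real part is
negative all three vanish, which forces `a = 0`. -/
theorem exists_cubeRoot_mul_re_neg {a : ℂ} (ha : a ≠ 0) :
    ∃ c : ℂ, c ^ 3 = 1 ∧ c * conj c = 1 ∧ (c * a).re < 0 := by
  have h3 : √3 * √3 = (3 : ℝ) := Real.mul_self_sqrt (by norm_num)
  by_contra! hcon
  have h0 := hcon 1 (by simp) (by simp)
  have h1 := hcon ⟨-1 / 2, √3 / 2⟩
    (by
      rw [pow_succ, pow_two]
      apply Complex.ext <;> simp
      · linear_combination (3 / 8) * h3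
      · linear_combination (-√3 / 8) * h3)
    (by apply Complex.ext <;> simp <;> nlinarith)
  have h2 := hcon ⟨-1 / 2, -(√3 / 2)⟩
    (by
      rw [pow_succ, pow_two]
      apply Complex.ext <;> simp
      · linear_combination (3 / 8) * h3
      · linear_combination (√3 / 8) * h3)
    (by apply Complex.ext <;> simp <;> nlinarith)
  simp only [one_mul, Complex.mul_re] at h0 h1 h2
  have hre : a.re = 0 := by linarith
  have him : √3 * a.im = 0 := by rw [hre] at h1 h2; linarith
  have h3' : √3 ≠ (0 : ℝ) := by positivity
  exact ha (Complex.ext hre (by simpa using him))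

theorem isElliptic_rot : IsElliptic (rot a z ha hz) := by
  obtain ⟨c, hc3, hc, hneg⟩ := exists_cubeRoot_mul_re_neg (left_ne_zero_of_mul_eq_one ha)
  -- With `M` the matrix, this is the sum of `cʲ Mʲ e₂` over `j = 0, 1, 2`, an eigenvector because
  -- `M³ = 1`. Its norm is `6 Re (c a)`, whence the choice of `c`.
  apply isElliptic_of_eigenvector (v := ![c * a + c ^ 2 * conj a, c ^ 2 * z, 1 + c ^ 2 * a ^ 2])
    (c := c ^ 2)
  · rw [mat_rot]
    ext i
    fin_cases i <;> simp [Matrix.mulVec, dotProduct, Fin.sum_univ_three]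
    · linear_combination c ^ 2 * hz + c * conj a * ha - (a + c * conj a) * hc3
    · linear_combination c * z * ha - c * z * hc3
    · linear_combination c ^ 2 * ha - c * a ^ 2 * hc3
  · have : herm ![c * a + c ^ 2 * conj a, c ^ 2 * z, 1 + c ^ 2 * a ^ 2]
        ![c * a + c ^ 2 * conj a, c ^ 2 * z, 1 + c ^ 2 * a ^ 2] =
        3 * (c * a + conj (c * a)) := by
      have hcc : conj c = c ^ 2 := by linear_combination c ^ 2 * hc - conj c * hc3
      rw [herm_apply]
      simp [hcc]
      linear_combination c ^ 6 * hz + (c ^ 4 * a + c ^ 5 * conj a) * ha +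
        (2 * a * c + conj a * c ^ 2) * hc3
    rw [this, Complex.add_conj]
    have : (3 * ((2 * (c * a).re : ℝ) : ℂ)).re = 6 * (c * a).re := by
      rw [Complex.mul_re, Complex.ofReal_re, Complex.ofReal_im]; simp; ring
    rw [this]; linarith

end rot

theorem isElliptic_inv {g : SU21} (h : IsElliptic g) : IsElliptic g⁻¹ := by
  obtain ⟨p, hp, hgp⟩ := h
  refine ⟨p, hp, ?_⟩
  rw [Subgroup.coe_inv, inv_smul_eq_iff, hgp]

/-! ### Reduction of the words in `A` and `B` to three elements -/

section words

variable {S T : SU21}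

/-- Here `S`, `T` play the roles of `J₁`, `J₂`, so `A = S * T` and `B = T * S`. Replacing inverses
by squares and cancelling cubes brings both sides to the same normal form. -/
theorem words_conjugate (hS : S ^ 3 = 1) (hT : T ^ 3 = 1) :
    T * S = S⁻¹ * (S * T) * S⁻¹⁻¹ ∧
    S * T * (T * S) = S * (S * T)⁻¹ * S⁻¹ ∧
    S * T * (T * S)⁻¹ = S * T * S⁻¹ * T⁻¹ ∧
    S * T * (T * S) ^ 2 = S * T⁻¹ * (S * T * S⁻¹ * T⁻¹) * (S * T⁻¹)⁻¹ ∧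
    (S * T) ^ 2 * (T * S) = S * (S * T * S⁻¹ * T⁻¹)⁻¹ * S⁻¹ ∧
    S * T * (T * S) * (S * T)⁻¹ * (T * S)⁻¹ = (S * T⁻¹) ^ 3 := by
  have hS1 : S * (S * S) = 1 := by rw [← hS, pow_succ, pow_two, mul_assoc]
  have hT1 : T * (T * T) = 1 := by rw [← hT, pow_succ, pow_two, mul_assoc]
  have hS2 : ∀ x, S * (S * (S * x)) = x := fun x => by
    calc S * (S * (S * x)) = S * (S * S) * x := by simp only [mul_assoc]
      _ = x := by rw [hS1, one_mul]
  have hT2 : ∀ x, T * (T * (T * x)) = x := fun x => by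
    calc T * (T * (T * x)) = T * (T * T) * x := by simp only [mul_assoc]
      _ = x := by rw [hT1, one_mul]
  have hSi : S⁻¹ = S * S := inv_eq_of_mul_eq_one_right hS1
  have hTi : T⁻¹ = T * T := inv_eq_of_mul_eq_one_right hT1
  simp only [mul_inv_rev, hSi, hTi, pow_succ, pow_zero, one_mul, mul_assoc, hS1, hT1, hS2, hT2,
    mul_one, and_self]

theorem isParabolic_words (hS : S ^ 3 = 1) (hT : T ^ 3 = 1) {x₁ y₁ x₂ y₂ x₃ y₃ : ℂ}
    (h₁ : HasJordanBlock (mat (S * T)) x₁ y₁) (h₂ : HasJordanBlock (mat (S * T⁻¹)) x₂ y₂)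
    (h₃ : HasJordanBlock (mat (S * T * S⁻¹ * T⁻¹)) x₃ y₃) (hne : x₂ ^ 3 ≠ y₂ ^ 3) :
    IsParabolic (S * T) ∧ IsParabolic (T * S) ∧
    IsParabolic (S * T * (T * S)) ∧ IsParabolic (S * T * (T * S)⁻¹) ∧
    IsParabolic (S * T * (T * S) ^ 2) ∧ IsParabolic ((S * T) ^ 2 * (T * S)) ∧
    IsParabolic (S * T * (T * S) * (S * T)⁻¹ * (T * S)⁻¹) := by
  obtain ⟨e1, e2, e3, e4, e5, e6⟩ := words_conjugate hS hT
  refine ⟨h₁.isParabolic, ?_, ?_, ?_, ?_, ?_, ?_⟩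
  · rw [e1]; exact (h₁.conj _).isParabolic
  · rw [e2]; exact (h₁.inv.conj _).isParabolic
  · rw [e3]; exact h₃.isParabolic
  · rw [e4]; exact (h₃.conj _).isParabolic
  · rw [e5]; exact (h₃.inv.conj _).isParabolic
  · rw [e6]; exact HasJordanBlock.isParabolic (h₂.cube hne)

end words

theorem continuous_mk_mat {f : ℝ → SU21} (h : Continuous fun t => mat (f t)) : Continuous f :=
  Continuous.subtype_mk (Continuous.subtype_mk h _) _

theorem mat_rot_inv {a z : ℂ} (ha : a * conj a = 1)
    (hz : z * conj z = -(a ^ 3 + conj a ^ 3)) : mat (rot a z ha hz)⁻¹ =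
    !![0, 0, conj a; 0, -a ^ 2, z; conj a, conj z * a, a ^ 2] := by
  rw [mat_inv, mat_rot]
  ext i j
  simp only [Matrix.mul_apply, Fin.sum_univ_three, Matrix.conjTranspose_apply]
  fin_cases i <;> fin_cases j <;> simp [formMatrix]

/-! ### Traces and minors for a pair of generators -/

section

variable {k l r z : ℂ}
  {ha : k * l * conj (k * l) = 1}
  {hrr : r * conj r = -((k * l) ^ 3 + conj (k * l) ^ 3)}
  {hb : k * conj l * conj (k * conj l) = 1}
  {hz : z * conj z = -((k * conj l) ^ 3 + conj (k * conj l) ^ 3)}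

/-- The product sends `e₀` through the line of `e₂` back to `l² e₀`, so it is upper triangular with
diagonal `l²`, `l̄⁴`, `l²`. No condition on `z` is needed for the trace to lie on the deltoid. -/
theorem trace_rot_mul_rot_inv (hk : k * conj k = 1) (hl : l * conj l = 1) :
    (mat (rot (k * l) r ha hrr * (rot (k * conj l) z hb hz)⁻¹)).trace =
      2 * l ^ 2 + conj (l ^ 2) ^ 2 := by
  rw [mat_mul, mat_rot, mat_rot_inv, Matrix.trace_fin_three]
  simp [Matrix.mul_apply, Fin.sum_univ_three]
  generalize conj k = k' at *
  generalize conj l = l' at *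
  grind

/-- For real `r` the bracket is real, so `k` carries the argument of the trace (up to sign) and the
real part of `r z l` adjusts its size. -/
theorem trace_rot_mul_rot (hk : k * conj k = 1) (hl : l * conj l = 1) (hr : conj r = r) :
    (mat (rot (k * l) r ha hrr * rot (k * conj l) z hb hz)).trace =
      conj k * (2 * (k ^ 3 + conj k ^ 3) + (r * z * l + r * conj z * conj l)) := by
  rw [mat_mul, mat_rot, mat_rot, Matrix.trace_fin_three]
  simp [Matrix.mul_apply, Fin.sum_univ_three, hr]
  generalize conj k = k' at *
  generalize conj l = l' at *
  generalize conj z = z' at *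
  grind

/-- This minor, like the two similar ones below, is the quantity required to be nonzero in
`hasJordanBlock_of_trace`. -/
theorem minor_rot_mul_rot (hk : k * conj k = 1) (hl : l * conj l = 1) (hr : conj r = r) (x : ℂ)
    {M} (hM : M = mat (rot (k * l) r ha hrr * rot (k * conj l) z hb hz)) :
    M 0 1 * M 1 2 - M 0 2 * (M 1 1 - x) = k * l ^ 3 + x * (conj k * conj l ^ 3) := by
  rw [mat_mul, mat_rot, mat_rot] at hM
  subst hM
  simp [Matrix.mul_apply, Fin.sum_univ_three, hr]
  have hrr' := hrr
  simp only [hr, map_mul] at hrr'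
  generalize conj k = k' at *
  generalize conj l = l' at *
  generalize conj z = z' at *
  grind

theorem minor_rot_mul_rot_inv (hk : k * conj k = 1) (hl : l * conj l = 1) (hr : conj r = r)
    {M} (hM : M = mat (rot (k * l) r ha hrr * (rot (k * conj l) z hb hz)⁻¹)) :
    M 0 1 * M 1 2 - M 0 2 * (M 1 1 - l ^ 2) =
      l * (2 * (k ^ 3 + conj k ^ 3) + (r * z * l + r * conj z * conj l)) := by
  rw [mat_mul, mat_rot, mat_rot_inv] at hM
  subst hM
  simp [Matrix.mul_apply, Fin.sum_univ_three, hr]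
  have hrr' := hrr
  have hz' := hz
  simp only [hr, map_mul, Complex.conj_conj] at hrr' hz'
  generalize conj k = k' at *
  generalize conj l = l' at *
  generalize conj z = z' at *
  grind

/-- The matrix of the commutator of the two generators. -/
theorem mat_commutator (hk : k * conj k = 1) (hl : l * conj l = 1) (hr : conj r = r) :
    mat (rot (k * l) r ha hrr * (rot (k * conj l) z hb hz)⁻¹ * (rot (k * l) r ha hrr)⁻¹ *
      rot (k * conj l) z hb hz) =
    !![l ^ 2, k ^ 2 * conj z - r * (k * conj l) ^ 2,
        conj k ^ 3 * conj l + r * z + k ^ 3 * conj l;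
      0, conj l ^ 4, r * conj k ^ 2 - conj k ^ 2 * conj l ^ 2 * z; 0, 0, l ^ 2] *
    !![conj l ^ 2, 0, 0; r * (k * conj l) - k * l ^ 3 * z, l ^ 4, 0;
      conj k ^ 3 * l + r * l ^ 2 * z + k ^ 3 * l,
      conj k * conj l * conj z - r * conj k * l ^ 3, conj l ^ 2] := by
  rw [mul_assoc, mat_mul, mat_mul, mat_mul, mat_rot, mat_rot, mat_rot_inv, mat_rot_inv]
  congr 1
  all_goals
    ext i j
    fin_cases i <;> fin_cases j <;> simp [Matrix.mul_apply, Fin.sum_univ_three, hr]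
    all_goals
      generalize conj k = k' at *
      generalize conj l = l' at *
      generalize conj z = z' at *
      grind

/-- Unlike the trace of `S T`, this one sees the imaginary part of `r z l`, the remaining freedom
once the real part is fixed. -/
theorem trace_commutator (hk : k * conj k = 1) (hl : l * conj l = 1) (hr : conj r = r) :
    (mat (rot (k * l) r ha hrr * (rot (k * conj l) z hb hz)⁻¹ * (rot (k * l) r ha hrr)⁻¹ *
      rot (k * conj l) z hb hz)).trace =
    2 * (k ^ 3 + conj k ^ 3) ^ 2 + 2 * (l ^ 3 + conj l ^ 3) ^ 2 - 5 +
      (r * z * l + r * conj z * conj l) * (k ^ 3 + conj k ^ 3) +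
      (k ^ 3 + conj k ^ 3 + r * z * l) ^ 2 := by
  rw [mat_commutator hk hl hr, Matrix.trace_fin_three]
  simp [Matrix.mul_apply, Fin.sum_univ_three]
  have hrr' := hrr
  have hz' := hz
  simp only [hr, map_mul, Complex.conj_conj] at hrr' hz'
  generalize conj k = k' at *
  generalize conj l = l' at *
  generalize conj z = z' at *
  grind

theorem minor_commutator (hk : k * conj k = 1) (hl : l * conj l = 1) (hr : conj r = r) (x : ℂ)
    {M} (hM : M = mat (rot (k * l) r ha hrr * (rot (k * conj l) z hb hz)⁻¹ *
      (rot (k * l) r ha hrr)⁻¹ * rot (k * conj l) z hb hz)) :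
    M 0 1 * M 1 2 - M 0 2 * (M 1 1 - x) =
      l ^ 3 * (k ^ 3 + conj k ^ 3 + r * conj z * conj l) +
      x * (conj l ^ 3 * (k ^ 3 + conj k ^ 3 + r * z * l)) := by
  rw [mat_commutator hk hl hr] at hM
  subst hM
  simp [Matrix.mul_apply, Fin.sum_univ_three]
  have hrr' := hrr
  have hz' := hz
  simp only [hr, map_mul, Complex.conj_conj] at hrr' hz'
  generalize conj k = k' at *
  generalize conj l = l' at *
  generalize conj z = z' at *
  grind

end

/-! ### The parameters of the family -/

noncomputable section

/-- The parameter of the family, which takes its values in the interval `(11/4, 3)`. -/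
def param (t : ℝ) : ℝ := 3 - 1 / (4 * (1 + Real.exp t))

theorem param_mem (t : ℝ) : 11 / 4 < param t ∧ param t < 3 := by
  have h := Real.exp_pos t
  have h1 : 0 < 1 / (4 * (1 + Real.exp t)) := by positivity
  have h2 : 1 / (4 * (1 + Real.exp t)) < 1 / 4 :=
    one_div_lt_one_div_of_lt (by norm_num) (by linarith)
  unfold param
  constructor <;> linarith

theorem param_injective : Function.Injective param := by
  intro s t h
  have hs := Real.exp_pos s
  have ht := Real.exp_pos t
  unfold param at h
  have h' : 1 / (4 * (1 + Real.exp s)) = 1 / (4 * (1 + Real.exp t)) := by linarith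
  rw [one_div, one_div, inv_inj] at h'
  exact Real.exp_injective (by linarith)

theorem continuous_param : Continuous param := by
  unfold param
  refine continuous_const.sub (continuous_const.div (by fun_prop) fun t => ?_)
  have := Real.exp_pos t
  positivity

/-- The square of the modulus of the trace of `J₁ J₂⁻¹`. -/
def normSqE (t : ℝ) : ℝ :=
  (param t ^ 2 + √(3 * param t ^ 4 - 16 * param t ^ 3 + 36 * param t ^ 2 - 108)) / 2

/-- The square of the modulus of the trace of `J₁ J₂`. -/
def normSqA (t : ℝ) : ℝ := param t ^ 2 - normSqE t

/-- This is the deltoid condition for the commutator. With their sum equal to `param t ^ 2`, the two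
squared moduli are the roots of one quadratic; `normSqE` is the larger. -/
theorem normSqA_mul_normSqE (t : ℝ) :
    2 * normSqA t * normSqE t - 27 = (3 - param t) ^ 3 * (param t + 1) := by
  obtain ⟨h1, h2⟩ := param_mem t
  unfold normSqA normSqE
  generalize param t = q at *
  have hD : 0 ≤ 3 * q ^ 4 - 16 * q ^ 3 + 36 * q ^ 2 - 108 := by
    -- Expanded around `11/4`, the discriminant has only positive coefficients.
    obtain ⟨e, he, rfl⟩ : ∃ e, 0 < e ∧ q = e + 11 / 4 := ⟨q - 11 / 4, by linarith, by ring⟩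
    ring_nf
    positivity
  have := Real.sq_sqrt hD
  linear_combination (-1 / 2) * this

/-- The bounds on `normSqA` put `cosL` strictly between `-1` and `0`; those on `normSqE` put `cosE`
strictly between `-1/2` and `1`. -/
theorem normSq_bounds (t : ℝ) :
    3 < normSqE t ∧ normSqE t < 9 ∧ 1 < normSqA t ∧ normSqA t < 9 := by
  obtain ⟨h1, h2⟩ := param_mem t
  have hp := normSqA_mul_normSqE t
  have hpos : 0 < (3 - param t) ^ 3 * (param t + 1) :=
    mul_pos (pow_pos (by linarith) 3) (by linarith)
  have hsum : normSqA t + normSqE t = param t ^ 2 := by unfold normSqA; ring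
  have hE : param t ^ 2 / 2 ≤ normSqE t := by
    unfold normSqE
    have := Real.sqrt_nonneg (3 * param t ^ 4 - 16 * param t ^ 3 + 36 * param t ^ 2 - 108)
    linarith
  generalize param t = q at *
  generalize normSqE t = v at *
  generalize normSqA t = u at *
  have hv : 3 < v := by nlinarith
  have hu : 0 < u := by
    by_contra h
    nlinarith
  have hv9 : v < 9 := by nlinarith
  refine ⟨hv, hv9, ?_, by nlinarith⟩
  by_contra h
  nlinarith

/-- The modulus of the trace of `J₁ J₂⁻¹`. -/
def absE (t : ℝ) : ℝ := √(normSqE t)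

theorem absE_pos (t : ℝ) : 0 < absE t := Real.sqrt_pos.2 (by linarith [normSq_bounds t])

theorem absE_sq (t : ℝ) : absE t ^ 2 = normSqE t :=
  Real.sq_sqrt (by linarith [normSq_bounds t])

/-- Twice the real part of `kE ^ 3`. -/
def traceK (t : ℝ) : ℝ :=
  (normSqE t ^ 2 + 18 * normSqE t - 27) / (4 * normSqE t * absE t)

theorem traceK_pos (t : ℝ) : 0 < traceK t := by
  obtain ⟨h1, -⟩ := normSq_bounds t
  have := absE_pos t
  unfold traceK
  apply div_pos
  · nlinarith
  · positivity

/-- The real part of `lA ^ 3`. -/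
def cosL (t : ℝ) : ℝ := -√((normSqA t - 1) / 8)

theorem cosL_sq (t : ℝ) : cosL t ^ 2 = (normSqA t - 1) / 8 := by
  rw [cosL, neg_sq, Real.sq_sqrt (by linarith [normSq_bounds t])]

theorem cosL_bounds (t : ℝ) : -1 < cosL t ∧ cosL t < 0 := by
  have h := normSq_bounds t
  have h2 := cosL_sq t
  have h3 : cosL t < 0 := neg_lt_zero.2 (Real.sqrt_pos.2 (by linarith))
  exact ⟨by nlinarith, h3⟩

/-- The real part of `eigE ^ 3`. -/
def cosE (t : ℝ) : ℝ := (normSqE t - 5) / 4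

theorem cosE_bounds (t : ℝ) : -1 / 2 < cosE t ∧ cosE t < 1 := by
  have h := normSq_bounds t
  unfold cosE
  constructor <;> linarith

theorem exp_mul_I_cube (x : ℝ) : Complex.exp ((x / 3 : ℝ) * Complex.I) ^ 3 =
    Real.cos x + Real.sin x * Complex.I := by
  rw [← Complex.exp_nat_mul, Complex.ofReal_cos, Complex.ofReal_sin, ← Complex.exp_mul_I]
  congr 1
  push_cast
  ring

theorem exp_mul_I_mul_conj (x : ℝ) :
    Complex.exp (x * Complex.I) * conj (Complex.exp (x * Complex.I)) = 1 := by
  rw [← Complex.exp_conj, ← Complex.exp_add]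
  simp

/-- A square root of the double eigenvalue of `J₁ J₂`. -/
def lA (t : ℝ) : ℂ := Complex.exp ((-Real.arccos (cosL t) / 3 : ℝ) * Complex.I)

/-- The double eigenvalue of `J₁ J₂⁻¹`. -/
def eigE (t : ℝ) : ℂ := Complex.exp ((Real.arccos (cosE t) / 3 : ℝ) * Complex.I)

theorem lA_mul_conj (t : ℝ) : lA t * conj (lA t) = 1 := exp_mul_I_mul_conj _

theorem eigE_mul_conj (t : ℝ) : eigE t * conj (eigE t) = 1 := exp_mul_I_mul_conj _

theorem lA_cube (t : ℝ) : lA t ^ 3 = cosL t - √(1 - cosL t ^ 2) * Complex.I := by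
  have h := cosL_bounds t
  rw [lA, exp_mul_I_cube, Real.cos_neg, Real.sin_neg, Real.sin_arccos,
    Real.cos_arccos (by linarith) (by linarith)]
  push_cast
  ring

theorem eigE_cube (t : ℝ) : eigE t ^ 3 = cosE t + √(1 - cosE t ^ 2) * Complex.I := by
  have h := cosE_bounds t
  rw [eigE, exp_mul_I_cube, Real.sin_arccos, Real.cos_arccos (by linarith) (by linarith)]

theorem lA_cube_add_conj (t : ℝ) : lA t ^ 3 + conj (lA t) ^ 3 = 2 * cosL t := by
  rw [← map_pow, lA_cube]
  simp
  ring

theorem eigE_cube_add_conj (t : ℝ) : eigE t ^ 3 + conj (eigE t) ^ 3 = 2 * cosE t := by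
  rw [← map_pow, eigE_cube]
  simp
  ring

theorem eigE_cube_im_pos (t : ℝ) : 0 < (eigE t ^ 3).im := by
  have h := cosE_bounds t
  have : (eigE t ^ 3).im = √(1 - cosE t ^ 2) := by rw [eigE_cube]; simp
  rw [this]
  exact Real.sqrt_pos.2 (by nlinarith)

/-- The branches of `lA` and `eigE` are chosen so that this sign and that of `eigE_cube_im_pos` are
positive; `minor_E_ne_zero` compares the two. -/
theorem lA_cube_sq_im_pos (t : ℝ) : 0 < ((lA t ^ 3) ^ 2).im := by
  have h := cosL_bounds t
  have h2 : 0 < √(1 - cosL t ^ 2) := Real.sqrt_pos.2 (by nlinarith)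
  have : ((lA t ^ 3) ^ 2).im = 2 * (-cosL t) * √(1 - cosL t ^ 2) := by
    rw [lA_cube, pow_two]
    simp
    ring
  rw [this]
  exact mul_pos (by linarith) h2

/-- The unimodular number `k` such that `J₁ J₂⁻¹` has trace `absE t / k`. -/
def kE (t : ℝ) : ℂ := (2 * conj (eigE t) + eigE t ^ 2) / absE t

theorem absE_mul_kE (t : ℝ) : absE t * kE t = 2 * conj (eigE t) + eigE t ^ 2 := by
  have : (absE t : ℂ) ≠ 0 := by exact_mod_cast (absE_pos t).ne'
  unfold kE
  field_simp

theorem absE_mul_conj_kE (t : ℝ) : absE t * conj (kE t) = 2 * eigE t + conj (eigE t) ^ 2 := by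
  simpa [map_ofNat] using congrArg conj (absE_mul_kE t)

theorem absE_sq_complex (t : ℝ) : (absE t : ℂ) ^ 2 = normSqE t := by
  exact_mod_cast absE_sq t

theorem normSqE_eq (t : ℝ) : (normSqE t : ℂ) = 5 + 4 * cosE t := by
  unfold cosE; push_cast; ring

theorem kE_mul_conj (t : ℝ) : kE t * conj (kE t) = 1 := by
  have h0 : (absE t : ℂ) ^ 2 ≠ 0 := by exact_mod_cast (pow_pos (absE_pos t) 2).ne'
  apply mul_left_cancel₀ h0
  have h1 := absE_mul_kE t
  have h2 := absE_mul_conj_kE t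
  calc (absE t : ℂ) ^ 2 * (kE t * conj (kE t)) = absE t * kE t * (absE t * conj (kE t)) := by ring
    _ = absE t ^ 2 * 1 := by
      rw [h1, h2, absE_sq_complex, normSqE_eq]
      linear_combination 2 * eigE_cube_add_conj t +
        (4 + eigE t * conj (eigE t) + 1) * eigE_mul_conj t

/-- The equation `|τ|⁴ - 8 Re τ³ + 18|τ|² - 27 = 0` of the deltoid, solved for the real part of the
cube of the normalised trace. -/
theorem kE_cube_add_conj (t : ℝ) : kE t ^ 3 + conj (kE t) ^ 3 = traceK t := by
  have hR : (absE t : ℂ) ≠ 0 := by exact_mod_cast (absE_pos t).ne'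
  have hv : (normSqE t : ℂ) ≠ 0 := by
    have := normSq_bounds t
    exact_mod_cast (by linarith : (0 : ℝ) < normSqE t).ne'
  have h0 : (absE t : ℂ) ^ 3 ≠ 0 := pow_ne_zero 3 hR
  have e : (absE t : ℂ) ^ 3 * traceK t = (normSqE t ^ 2 + 18 * normSqE t - 27) / 4 := by
    unfold traceK
    push_cast
    field_simp
    linear_combination (normSqE t ^ 2 + 18 * normSqE t - 27) * absE_sq_complex t
  apply mul_left_cancel₀ h0
  rw [e, mul_add, ← mul_pow, ← mul_pow, absE_mul_kE, absE_mul_conj_kE, normSqE_eq]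
  have h1 := eigE_cube_add_conj t
  have h2 := eigE_mul_conj t
  generalize eigE t = m at *
  generalize conj m = m' at *
  grind

/-- The imaginary part of the double eigenvalue of the commutator `[J₁, J₂]`. -/
def sinC (t : ℝ) : ℝ := √(1 - ((param t - 1) / 2) ^ 2)

/-- The imaginary part of the trace of the commutator `[J₁, J₂]`. -/
def imC (t : ℝ) : ℝ := sinC t * (3 - param t)

theorem sinC_pos (t : ℝ) : 0 < sinC t := by
  have := param_mem t
  exact Real.sqrt_pos.2 (by nlinarith)

theorem sinC_sq (t : ℝ) : sinC t ^ 2 = 1 - ((param t - 1) / 2) ^ 2 := by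
  have := param_mem t
  exact Real.sq_sqrt (by nlinarith)

theorem imC_pos (t : ℝ) : 0 < imC t := mul_pos (sinC_pos t) (by linarith [param_mem t])

theorem imC_sq (t : ℝ) : 4 * imC t ^ 2 = 2 * normSqA t * normSqE t - 27 := by
  rw [normSqA_mul_normSqE, imC, mul_pow, sinC_sq]
  ring

/-- The double eigenvalue of the commutator `[J₁, J₂]`. -/
def eigC (t : ℝ) : ℂ := ⟨(param t - 1) / 2, sinC t⟩

theorem eigC_mul_conj (t : ℝ) : eigC t * conj (eigC t) = 1 := by
  have := sinC_sq t
  apply Complex.ext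
  · simp [eigC]; linear_combination this
  · simp [eigC]; ring

theorem eigC_cube_ne_one (t : ℝ) : eigC t ^ 3 ≠ 1 := by
  intro h
  have h1 := congrArg Complex.im h
  have h2 := param_mem t
  have h3 := sinC_pos t
  have h4 := sinC_sq t
  rw [pow_succ, pow_two] at h1
  simp [eigC] at h1
  have : sinC t * (param t * (param t - 2)) = 0 := by
    linear_combination h1 + sinC t * h4
  have h5 : 0 < param t * (param t - 2) := mul_pos (by linarith) (by linarith)
  have := mul_pos h3 h5
  linarith

theorem eigC_trace (t : ℝ) :
    2 * eigC t + conj (eigC t) ^ 2 = ⟨(param t ^ 2 - 3) / 2, imC t⟩ := by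
  have h := sinC_sq t
  rw [pow_two]
  apply Complex.ext
  · simp [eigC]; linear_combination -h
  · simp [eigC, imC]; ring

/-- The product of the off-diagonal parameters of the generators, normalised by `lA`. -/
def wC (t : ℝ) : ℂ := ⟨absE t / 2 - traceK t, imC t / absE t⟩

theorem wC_add_conj (t : ℝ) : wC t + conj (wC t) = absE t - 2 * traceK t := by
  apply Complex.ext
  · simp [wC]; ring
  · simp [wC]

/-- The real part of `wC` is dictated by the trace of `J₁J₂⁻¹` and the imaginary part by that of the
commutator. Its modulus must also equal the product of the moduli of the off-diagonal parameters,
and this compatibility is precisely `imC_sq`. -/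
theorem wC_mul_conj (t : ℝ) :
    wC t * conj (wC t) = ((traceK t ^ 2 + (normSqA t - 9) / 2 : ℝ) : ℂ) := by
  have hR := (absE_pos t).ne'
  have h1 := absE_sq t
  have h2 := imC_sq t
  have hv : normSqE t ≠ 0 := by linarith [normSq_bounds t]
  have e : 4 * normSqE t * (absE t * traceK t) = normSqE t ^ 2 + 18 * normSqE t - 27 := by
    unfold traceK; field_simp
  rw [Complex.mul_conj]
  congr 1
  simp only [wC, Complex.normSq_mk]
  have h3 : (imC t / absE t) ^ 2 * (4 * normSqE t) = 2 * normSqA t * normSqE t - 27 := by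
    rw [div_pow, h1, ← h2]; field_simp
  apply mul_left_cancel₀ (mul_ne_zero four_ne_zero hv)
  linear_combination h3 + normSqE t * h1 - e

theorem wC_normSq_pos (t : ℝ) : 0 < traceK t ^ 2 + (normSqA t - 9) / 2 := by
  have h := wC_mul_conj t
  rw [Complex.mul_conj] at h
  have h' : Complex.normSq (wC t) = traceK t ^ 2 + (normSqA t - 9) / 2 := by exact_mod_cast h
  rw [← h']
  apply Complex.normSq_pos.2
  intro h0
  have := congrArg Complex.im h0
  exact (div_pos (imC_pos t) (absE_pos t)).ne' this

/-- The square of the off-diagonal parameter of `J₁`. -/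
def sqR (t : ℝ) : ℝ := -2 * ((kE t * lA t) ^ 3).re

theorem ofReal_sqR (t : ℝ) : (sqR t : ℂ) = -((kE t * lA t) ^ 3 + conj (kE t * lA t) ^ 3) := by
  rw [← map_pow, Complex.add_conj, sqR]
  push_cast
  ring

/-- `sqR` and its counterpart for `genT` have product `|wC|² > 0` and sum `-2 * traceK * cosL > 0`,
so both are positive. The sign of `cosL` was chosen for this. -/
theorem sqR_pos (t : ℝ) : 0 < sqR t ∧
    (sqR t : ℂ) * -((kE t * conj (lA t)) ^ 3 + conj (kE t * conj (lA t)) ^ 3) =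
      wC t * conj (wC t) := by
  have hk := kE_mul_conj t
  have hl := lA_mul_conj t
  have hK := kE_cube_add_conj t
  have hL := lA_cube_add_conj t
  have hY : (cosL t : ℂ) ^ 2 = (normSqA t - 1) / 8 := by exact_mod_cast cosL_sq t
  have hprod : (sqR t : ℂ) * -((kE t * conj (lA t)) ^ 3 + conj (kE t * conj (lA t)) ^ 3) =
      wC t * conj (wC t) := by
    rw [wC_mul_conj, ofReal_sqR]
    push_cast
    simp only [map_mul, Complex.conj_conj]
    generalize conj (kE t) = k' at *
    generalize conj (lA t) = l' at *
    generalize kE t = k at *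
    generalize lA t = l at *
    have hk3 : k ^ 3 * k' ^ 3 = 1 := by rw [← mul_pow, hk, one_pow]
    have hl3 : l ^ 3 * l' ^ 3 = 1 := by rw [← mul_pow, hl, one_pow]
    clear hk hl
    simp only [mul_pow]
    generalize k ^ 3 = K at *
    generalize k' ^ 3 = K' at *
    generalize l ^ 3 = L at *
    generalize l' ^ 3 = L' at *
    grind
  refine ⟨?_, hprod⟩
  set q := -2 * ((kE t * conj (lA t)) ^ 3).re with hq
  have hq' : (q : ℂ) = -((kE t * conj (lA t)) ^ 3 + conj (kE t * conj (lA t)) ^ 3) := by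
    rw [← map_pow, Complex.add_conj, hq]
    push_cast
    ring
  have h1 : sqR t * q = traceK t ^ 2 + (normSqA t - 9) / 2 := by
    rw [← hq', wC_mul_conj] at hprod
    exact_mod_cast hprod
  have h2 : sqR t + q = -(traceK t * (2 * cosL t)) := by
    have : (sqR t : ℂ) + q = -(traceK t * (2 * cosL t)) := by
      rw [hq', ofReal_sqR, ← hK, ← hL]
      simp only [map_mul, Complex.conj_conj]
      ring
    exact_mod_cast this
  have h3 := wC_normSq_pos t
  have h4 := mul_pos (traceK_pos t) (neg_pos.2 (cosL_bounds t).2)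
  rw [← h1] at h3
  by_contra hcon
  have hqneg : q < 0 := by nlinarith
  linarith

/-- The off-diagonal parameter of `J₁`. -/
def offR (t : ℝ) : ℂ := (√(sqR t) : ℝ)

theorem conj_offR (t : ℝ) : conj (offR t) = offR t := Complex.conj_ofReal _

theorem offR_mul_self (t : ℝ) : offR t * offR t = sqR t := by
  rw [offR, ← Complex.ofReal_mul, Real.mul_self_sqrt (sqR_pos t).1.le]

theorem offR_ne_zero (t : ℝ) : offR t ≠ 0 := by
  have := (Real.sqrt_pos.2 (sqR_pos t).1).ne'
  unfold offR
  exact_mod_cast this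

theorem lA_ne_zero (t : ℝ) : lA t ≠ 0 := left_ne_zero_of_mul_eq_one (lA_mul_conj t)

/-- The off-diagonal parameter of `J₂⁻¹`. -/
def offZ (t : ℝ) : ℂ := wC t / (offR t * lA t)

theorem offR_mul_offZ_mul_lA (t : ℝ) : offR t * offZ t * lA t = wC t := by
  have := lA_ne_zero t
  have := offR_ne_zero t
  unfold offZ
  field_simp

theorem offR_mul_conj_offZ_mul_conj_lA (t : ℝ) :
    offR t * conj (offZ t) * conj (lA t) = conj (wC t) := by
  simpa [conj_offR] using congrArg conj (offR_mul_offZ_mul_lA t)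

theorem kl_mul_conj (t : ℝ) : kE t * lA t * conj (kE t * lA t) = 1 := by
  rw [map_mul]
  linear_combination lA t * conj (lA t) * kE_mul_conj t + lA_mul_conj t

theorem kl'_mul_conj (t : ℝ) : kE t * conj (lA t) * conj (kE t * conj (lA t)) = 1 := by
  rw [map_mul, Complex.conj_conj]
  linear_combination lA t * conj (lA t) * kE_mul_conj t + lA_mul_conj t

theorem offR_mul_conj (t : ℝ) :
    offR t * conj (offR t) = -((kE t * lA t) ^ 3 + conj (kE t * lA t) ^ 3) := by
  rw [conj_offR, offR_mul_self, ofReal_sqR]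

theorem offZ_mul_conj (t : ℝ) : offZ t * conj (offZ t) =
    -((kE t * conj (lA t)) ^ 3 + conj (kE t * conj (lA t)) ^ 3) := by
  have h0 : (sqR t : ℂ) ≠ 0 := by exact_mod_cast (sqR_pos t).1.ne'
  apply mul_left_cancel₀ h0
  rw [(sqR_pos t).2, ← offR_mul_self, ← offR_mul_offZ_mul_lA, map_mul, map_mul, conj_offR]
  linear_combination -offR t * offR t * offZ t * conj (offZ t) * lA_mul_conj t

/-- The first generator of the family. -/
def genS (t : ℝ) : SU21 := rot (kE t * lA t) (offR t) (kl_mul_conj t) (offR_mul_conj t)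

/-- The inverse of the second generator of the family. -/
def genT (t : ℝ) : SU21 := rot (kE t * conj (lA t)) (offZ t) (kl'_mul_conj t) (offZ_mul_conj t)

end

/-! ### Jordan blocks of `J₁J₂`, `J₁J₂⁻¹` and the commutator -/

theorem two_mul_kE_cube_add_wC (t : ℝ) :
    2 * (kE t ^ 3 + conj (kE t) ^ 3) +
      (offR t * offZ t * lA t + offR t * conj (offZ t) * conj (lA t)) = absE t := by
  rw [offR_mul_offZ_mul_lA, offR_mul_conj_offZ_mul_conj_lA, wC_add_conj, kE_cube_add_conj]
  ring

theorem hasJordanBlock_mul_inv (t : ℝ) :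
    HasJordanBlock (mat (genS t * (genT t)⁻¹)) (lA t ^ 2) (conj (lA t ^ 2) ^ 2) := by
  have hl := lA_mul_conj t
  refine hasJordanBlock_of_trace (by rw [map_pow, ← mul_pow, hl, one_pow]) (fun h => ?_)
    (trace_rot_mul_rot_inv (kE_mul_conj t) hl) ?_
  · have h1 := lA_cube_sq_im_pos t
    rw [← pow_mul, mul_comm, pow_mul, h] at h1
    simp at h1
  · refine ne_of_eq_of_ne (minor_rot_mul_rot_inv (kE_mul_conj t) hl (conj_offR t) rfl) ?_
    rw [two_mul_kE_cube_add_wC]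
    exact mul_ne_zero (lA_ne_zero t) (by exact_mod_cast (absE_pos t).ne')

theorem eigE_cube_ne_one (t : ℝ) : eigE t ^ 3 ≠ 1 := fun h => by
  have h1 := eigE_cube_im_pos t
  simp [h] at h1

/-- If the minor vanished, then `normSqE * lA⁶` would equal `-(4m³ + 4 + m̄³)` with `m = eigE`. The
left side has positive imaginary part, the right side `-3 Im m³ < 0`. -/
theorem minor_E_ne_zero (t : ℝ) :
    kE t * lA t ^ 3 + eigE t * (conj (kE t) * conj (lA t) ^ 3) ≠ 0 := by
  intro h0
  have hk := kE_mul_conj t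
  have hl := lA_mul_conj t
  have hm := eigE_mul_conj t
  have hR := absE_mul_conj_kE t
  have hl3 : lA t ^ 3 * conj (lA t) ^ 3 = 1 := by rw [← mul_pow, hl, one_pow]
  have h1 : (normSqE t : ℂ) * (lA t ^ 3) ^ 2 =
      -(4 * eigE t ^ 3 + 4 + conj (eigE t ^ 3)) := by
    have h2 : (lA t ^ 3) ^ 2 = -eigE t * conj (kE t) ^ 2 := by
      linear_combination lA t ^ 3 * conj (kE t) * h0 - (lA t ^ 3) ^ 2 * hk -
        eigE t * conj (kE t) ^ 2 * hl3
    rw [h2, ← absE_sq_complex, map_pow]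
    calc (absE t : ℂ) ^ 2 * (-eigE t * conj (kE t) ^ 2)
        = -eigE t * (absE t * conj (kE t)) ^ 2 := by ring
      _ = _ := by
        rw [hR]
        linear_combination (-4 * (eigE t * conj (eigE t) + 1) - conj (eigE t) ^ 3) * hm
  have h2 := congrArg Complex.im h1
  rw [Complex.im_ofReal_mul] at h2
  simp only [Complex.neg_im, Complex.add_im, Complex.conj_im, Complex.mul_im] at h2
  have h3 := mul_pos (by linarith [normSq_bounds t] : 0 < normSqE t) (lA_cube_sq_im_pos t)
  have h4 := eigE_cube_im_pos t
  simp at h2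
  linarith

theorem hasJordanBlock_mul (t : ℝ) :
    HasJordanBlock (mat (genS t * genT t)) (eigE t) (conj (eigE t) ^ 2) := by
  refine hasJordanBlock_of_trace (eigE_mul_conj t) (eigE_cube_ne_one t) ?_ ?_
  · rw [← absE_mul_conj_kE, mul_comm, ← two_mul_kE_cube_add_wC]
    exact trace_rot_mul_rot (kE_mul_conj t) (lA_mul_conj t) (conj_offR t)
  · exact ne_of_eq_of_ne
      (minor_rot_mul_rot (kE_mul_conj t) (lA_mul_conj t) (conj_offR t) _ rfl) (minor_E_ne_zero t)

/-- Equality would make `eigE ^ 3` a cube root of unity, with real part `1` or `-1/2`; both are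
excluded by `cosE_bounds`. -/
theorem eigE_cube_ne (t : ℝ) : eigE t ^ 3 ≠ (conj (eigE t) ^ 2) ^ 3 := by
  intro h
  have hm := eigE_mul_conj t
  have hc := cosE_bounds t
  have h1 := eigE_cube_add_conj t
  have hm3 : eigE t ^ 3 * conj (eigE t) ^ 3 = 1 := by rw [← mul_pow, hm, one_pow]
  have h2 : eigE t ^ 3 = conj (eigE t) ^ 3 * conj (eigE t) ^ 3 := by rw [h]; ring
  have h3 := congrArg conj h2
  simp only [map_mul, map_pow, Complex.conj_conj] at h3
  have h4 : (2 * cosE t + 1) * (cosE t - 1) = 0 := by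
    have : (2 * (cosE t : ℂ) + 1) * (cosE t - 1) = 0 := by
      generalize eigE t ^ 3 = M at *
      generalize conj (eigE t) ^ 3 = M' at *
      grind
    exact_mod_cast this
  rcases mul_eq_zero.1 h4 with h5 | h5 <;> linarith

theorem traceK_add_wC (t : ℝ) : traceK t + wC t = ⟨absE t / 2, imC t / absE t⟩ := by
  apply Complex.ext <;> simp [wC]

theorem trace_commutator_eq (t : ℝ) :
    (mat (genS t * (genT t)⁻¹ * (genS t)⁻¹ * genT t)).trace =
      ⟨(param t ^ 2 - 3) / 2, imC t⟩ := by
  refine (trace_commutator (kE_mul_conj t) (lA_mul_conj t) (conj_offR t)).trans ?_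
  rw [kE_cube_add_conj, lA_cube_add_conj, offR_mul_offZ_mul_lA, offR_mul_conj_offZ_mul_conj_lA,
    wC_add_conj, traceK_add_wC]
  have hR := (absE_pos t).ne'
  have h1 := absE_sq t
  have h2 := imC_sq t
  have h3 := cosL_sq t
  have hv : normSqE t ≠ 0 := by linarith [normSq_bounds t]
  have hs : normSqA t + normSqE t = param t ^ 2 := by unfold normSqA; ring
  have e : 4 * normSqE t * (absE t * traceK t) = normSqE t ^ 2 + 18 * normSqE t - 27 := by
    unfold traceK; field_simp
  have h4 : (imC t / absE t) ^ 2 * (4 * normSqE t) = 2 * normSqA t * normSqE t - 27 := by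
    rw [div_pow, h1, ← h2]; field_simp
  apply Complex.ext
  · simp [pow_two]
    apply mul_left_cancel₀ (mul_ne_zero four_ne_zero hv)
    linear_combination 32 * normSqE t * h3 + e + normSqE t * h1 - h4 + 2 * normSqE t * hs
  · simp [pow_two]
    field_simp
    ring

/-- With `h = traceK + wC`, vanishing would give `lA⁶ |h|² = -eigC h²`. The left side has positive
imaginary part; since `h` has argument in `(0, π/4)` and `eigC` lies in the open first quadrant, the
right side has negative imaginary part. -/
theorem minor_C_ne_zero (t : ℝ) :
    lA t ^ 3 * (traceK t + conj (wC t)) + eigC t * (conj (lA t) ^ 3 * (traceK t + wC t)) ≠ 0 := by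
  intro h0
  have hl := lA_mul_conj t
  have hl3 : lA t ^ 3 * conj (lA t) ^ 3 = 1 := by rw [← mul_pow, hl, one_pow]
  have hw : traceK t + conj (wC t) = conj (traceK t + wC t) := by simp
  rw [hw] at h0
  set h := (traceK t : ℂ) + wC t with hdef
  have h1 : (lA t ^ 3) ^ 2 * (h * conj h) = -(eigC t * h ^ 2) := by
    linear_combination lA t ^ 3 * h * h0 - eigC t * h ^ 2 * hl3
  have hR := absE_pos t
  have hs := imC_pos t
  have hpos : 0 < imC t / absE t := div_pos hs hR
  have hh : h = ⟨absE t / 2, imC t / absE t⟩ := traceK_add_wC t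
  -- Equivalent to `2 imC < normSqE`: here `imC < 3 - param t < 1/4`, while `normSqE > 3`.
  have hlt : imC t / absE t < absE t / 2 := by
    rw [div_lt_div_iff₀ hR two_pos, ← pow_two, absE_sq]
    obtain ⟨p1, p2⟩ := param_mem t
    have h5 := normSq_bounds t
    have h6 : sinC t < 1 := by
      have := sinC_sq t
      nlinarith [sinC_pos t]
    unfold imC
    nlinarith [sinC_pos t]
  have hnorm : 0 < Complex.normSq h := by
    apply Complex.normSq_pos.2
    intro h5
    have := congrArg Complex.im (hh.symm.trans h5)
    exact hpos.ne' this
  rw [Complex.mul_conj] at h1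
  have h2 := congrArg Complex.im h1
  have h8 : (eigC t * h ^ 2).im = (param t - 1) / 2 * (absE t * (imC t / absE t)) +
      sinC t * (absE t / 2 * (absE t / 2) - imC t / absE t * (imC t / absE t)) := by
    rw [hh, pow_two]
    simp only [eigC, Complex.mul_im, Complex.mul_re]
    ring
  rw [Complex.im_mul_ofReal, Complex.neg_im, h8] at h2
  have h3 := mul_pos (lA_cube_sq_im_pos t) hnorm
  have h4 : 0 < (param t - 1) / 2 := by linarith [param_mem t]
  have h5 := sinC_pos t
  have h6 := mul_pos h4 (mul_pos hR hpos)
  have h7 : 0 < sinC t * (absE t / 2 * (absE t / 2) - imC t / absE t * (imC t / absE t)) :=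
    mul_pos h5 (by nlinarith)
  linarith

theorem hasJordanBlock_commutator (t : ℝ) :
    HasJordanBlock (mat (genS t * (genT t)⁻¹ * (genS t)⁻¹ * genT t)) (eigC t)
      (conj (eigC t) ^ 2) := by
  refine hasJordanBlock_of_trace (eigC_mul_conj t) (eigC_cube_ne_one t) ?_ ?_
  · rw [trace_commutator_eq, eigC_trace]
  · refine ne_of_eq_of_ne
      (minor_commutator (kE_mul_conj t) (lA_mul_conj t) (conj_offR t) _ rfl) ?_
    rw [kE_cube_add_conj, offR_mul_offZ_mul_lA, offR_mul_conj_offZ_mul_conj_lA]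
    exact minor_C_ne_zero t

/-! ### Continuity of the family -/

theorem continuous_normSqE : Continuous normSqE := by
  have := continuous_param
  unfold normSqE
  fun_prop

theorem continuous_lA : Continuous lA := by
  have := continuous_param
  have := continuous_normSqE
  have h : Continuous normSqA := by unfold normSqA; fun_prop
  have h2 : Continuous cosL := by unfold cosL; fun_prop
  have h3 : Continuous fun t => Real.arccos (cosL t) := Real.continuous_arccos.comp h2
  unfold lA
  fun_prop

theorem continuous_absE : Continuous absE := Real.continuous_sqrt.comp continuous_normSqE

theorem continuous_kE : Continuous kE := by
  have := continuous_normSqE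
  have := continuous_absE
  have h2 : Continuous cosE := by unfold cosE; fun_prop
  have h3 : Continuous fun t => Real.arccos (cosE t) := Real.continuous_arccos.comp h2
  have h4 : Continuous eigE := by unfold eigE; fun_prop
  have h5 : Continuous fun t => conj (eigE t) := Complex.continuous_conj.comp h4
  unfold kE
  refine Continuous.div (by fun_prop) (by fun_prop) fun t => ?_
  exact_mod_cast (absE_pos t).ne'

theorem continuous_offR : Continuous offR := by
  have := continuous_kE
  have := continuous_lA
  have h : Continuous sqR := by
    unfold sqR
    exact continuous_const.mul (Complex.continuous_re.comp (by fun_prop))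
  unfold offR
  fun_prop

theorem continuous_wC : Continuous wC := by
  have := continuous_param
  have := continuous_normSqE
  have := continuous_absE
  have h1 : Continuous traceK := by
    unfold traceK
    refine Continuous.div (by fun_prop) (by fun_prop) fun t => ?_
    have := absE_pos t
    have := normSq_bounds t
    exact mul_ne_zero (by linarith) (by linarith)
  have h2 : Continuous imC := by unfold imC sinC; fun_prop
  have h3 : Continuous fun t => imC t / absE t := h2.div continuous_absE fun t => (absE_pos t).ne'
  have e : wC = fun t => ((absE t / 2 - traceK t : ℝ) : ℂ) + (imC t / absE t : ℝ) * Complex.I := by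
    funext t
    apply Complex.ext <;> simp [wC]
  rw [e]
  fun_prop

theorem continuous_offZ : Continuous offZ :=
  continuous_wC.div (continuous_offR.mul continuous_lA)
    fun t => mul_ne_zero (offR_ne_zero t) (lA_ne_zero t)

theorem continuous_rot {a z : ℝ → ℂ} (ha : ∀ t, a t * conj (a t) = 1)
    (hz : ∀ t, z t * conj (z t) = -(a t ^ 3 + conj (a t) ^ 3)) (hca : Continuous a)
    (hcz : Continuous z) : Continuous fun t => rot (a t) (z t) (ha t) (hz t) := by
  have hca' : Continuous fun t => conj (a t) := Complex.continuous_conj.comp hca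
  have hcz' : Continuous fun t => conj (z t) := Complex.continuous_conj.comp hcz
  apply continuous_mk_mat
  refine continuous_matrix fun i j => ?_
  fin_cases i <;> fin_cases j <;> simp [mat_rot] <;> fun_prop

theorem continuous_genS : Continuous genS :=
  continuous_rot _ _ (continuous_kE.mul continuous_lA) continuous_offR

theorem continuous_genT : Continuous genT :=
  continuous_rot _ _ (continuous_kE.mul (Complex.continuous_conj.comp continuous_lA))
    continuous_offZ

/-! ### Non-conjugacy and countability -/

theorem trace_conj (g h : SU21) : (mat (g * h * g⁻¹)).trace = (mat h).trace := by
  rw [mat_mul, Matrix.trace_mul_comm, ← mat_mul, inv_mul_cancel_left]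

/-- If the pairs of a family are pairwise not conjugate, then each subgroup they generate is
conjugate to at most countably many others. -/
theorem countable_conj_gen {A B : ℝ → SU21}
    (h : ∀ s t, s ≠ t → ¬ ∃ g : SU21, g * A s * g⁻¹ = A t ∧ g * B s * g⁻¹ = B t) (s : ℝ) :
    {t | ∃ g : SU21, (gen (A t) (B t)).map (MulAut.conj g).toMonoidHom =
      gen (A s) (B s)}.Countable := by
  have hc : Countable (gen (A s) (B s)) := by
    rw [gen, FreeGroup.closure_eq_range]
    have : Countable (FreeGroup ({A s, B s} : Set SU21)) := Quot.mk_surjective.countable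
    exact (MonoidHom.rangeRestrict_surjective _).countable
  have hex : ∀ t : {t | ∃ g : SU21, (gen (A t) (B t)).map (MulAut.conj g).toMonoidHom =
      gen (A s) (B s)}, ∃ g : SU21, g * A t * g⁻¹ ∈ gen (A s) (B s) ∧
        g * B t * g⁻¹ ∈ gen (A s) (B s) := by
    rintro ⟨t, g, hg⟩
    exact ⟨g, hg.le ⟨A t, Subgroup.subset_closure (by simp), rfl⟩,
      hg.le ⟨B t, Subgroup.subset_closure (by simp), rfl⟩⟩
  choose g hgA hgB using hex
  -- Each `t` is sent to the conjugated pair inside the countable group for `s`; equal images would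
  -- make two pairs of the family conjugate.
  refine Set.countable_coe_iff.1 (Function.Injective.countable (β := gen (A s) (B s) ×
    gen (A s) (B s)) (f := fun t => (⟨_, hgA t⟩, ⟨_, hgB t⟩)) fun t t' htt => ?_)
  by_contra hne
  simp only [Prod.mk.injEq, Subtype.mk.injEq] at htt
  refine h t t' (fun e => hne (Subtype.ext e)) ⟨(g t')⁻¹ * g t, ?_, ?_⟩
  · calc _ = (g t')⁻¹ * (g t * A t * (g t)⁻¹) * g t' := by group
      _ = A t' := by rw [htt.1]; group
  · calc _ = (g t')⁻¹ * (g t * B t * (g t)⁻¹) * g t' := by group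
      _ = B t' := by rw [htt.2]; group

end CxHyp

theorem corollary4p8 :
    ∃ J₁ J₂ A B : ℝ → CxHyp.SU21,
      -- a continuous one-parameter family
      Continuous J₁ ∧ Continuous J₂ ∧ Continuous A ∧ Continuous B ∧
      -- of groups generated by two elliptic elements of order three
      (∀ t, CxHyp.IsElliptic (J₁ t) ∧ orderOf (J₁ t) = 3 ∧
        CxHyp.IsElliptic (J₂ t) ∧ orderOf (J₂ t) = 3 ∧
        CxHyp.IsParabolic (J₁ t * J₂ t) ∧ CxHyp.IsParabolic (J₁ t * (J₂ t)⁻¹) ∧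
        CxHyp.IsParabolic (J₁ t * J₂ t * (J₁ t)⁻¹ * (J₂ t)⁻¹)) ∧
      -- and of their subgroups generated by `A` and `B`
      (∀ t, A t = J₁ t * J₂ t ∧ B t = J₂ t * J₁ t) ∧
      (∀ t, CxHyp.IsParabolic (A t) ∧ CxHyp.IsParabolic (B t) ∧
        CxHyp.IsParabolic (A t * B t) ∧ CxHyp.IsParabolic (A t * (B t)⁻¹) ∧
        CxHyp.IsParabolic (A t * B t ^ 2) ∧ CxHyp.IsParabolic (A t ^ 2 * B t) ∧
        CxHyp.IsParabolic (A t * B t * (A t)⁻¹ * (B t)⁻¹)) ∧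
      -- the pairs `(A, B)` are pairwise not conjugate
      (∀ s t, s ≠ t →
        ¬ ∃ g : CxHyp.SU21, g * A s * g⁻¹ = A t ∧ g * B s * g⁻¹ = B t) ∧
      -- each group `⟨A, B⟩` is conjugate to at most countably many others of the family
      (∀ s, {t | ∃ g : CxHyp.SU21,
        (CxHyp.gen (A t) (B t)).map (MulAut.conj g).toMonoidHom =
          CxHyp.gen (A s) (B s)}.Countable) := by
  open CxHyp in
  have hS : ∀ t, genS t ^ 3 = 1 := fun t => rot_cube _ _
  have hT : ∀ t, (genT t)⁻¹ ^ 3 = 1 := fun t => by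
    rw [inv_pow, inv_eq_one]; exact rot_cube _ _
  have hne : ∀ s t, s ≠ t → ¬ ∃ g : SU21, g * (genS s * (genT s)⁻¹) * g⁻¹ = genS t * (genT t)⁻¹ ∧
      g * ((genT s)⁻¹ * genS s) * g⁻¹ = (genT t)⁻¹ * genS t := by
    rintro s t hst ⟨g, hA, hB⟩
    -- The commutator of `J₁` and `J₂` is `A B⁻¹`, so conjugating the pair `(A, B)` conjugates it
    -- and preserves its trace, whose real part is injective in `t`.
    have e : ∀ t, genS t * (genT t)⁻¹ * (genS t)⁻¹ * genT t =
        genS t * (genT t)⁻¹ * ((genT t)⁻¹ * genS t)⁻¹ := fun t => by group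
    have h1 : genS t * (genT t)⁻¹ * (genS t)⁻¹ * genT t =
        g * (genS s * (genT s)⁻¹ * (genS s)⁻¹ * genT s) * g⁻¹ := by
      rw [e, e, ← hA, ← hB]; group
    have h2 := congrArg (fun h => (mat h).trace.re) h1
    simp only [trace_conj, trace_commutator_eq] at h2
    have ps := param_mem s
    have pt := param_mem t
    exact hst (param_injective (by nlinarith))
  refine ⟨genS, fun t => (genT t)⁻¹, fun t => genS t * (genT t)⁻¹, fun t => (genT t)⁻¹ * genS t,
    continuous_genS, continuous_genT.inv, continuous_genS.mul continuous_genT.inv,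
    continuous_genT.inv.mul continuous_genS, fun t => ⟨isElliptic_rot _ _, orderOf_rot _ _,
      isElliptic_inv (isElliptic_rot _ _), (orderOf_inv _).trans (orderOf_rot _ _),
      (hasJordanBlock_mul_inv t).isParabolic, ?_, ?_⟩, fun t => ⟨rfl, rfl⟩,
    fun t => isParabolic_words (hS t) (hT t) (hasJordanBlock_mul_inv t)
      (x₂ := eigE t) (y₂ := (starRingEnd ℂ) (eigE t) ^ 2) ?_
      (x₃ := eigC t) (y₃ := (starRingEnd ℂ) (eigC t) ^ 2) ?_ (eigE_cube_ne t),
    hne, countable_conj_gen hne⟩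
  all_goals simp only [inv_inv]
  · exact (hasJordanBlock_mul t).isParabolic
  · exact (hasJordanBlock_commutator t).isParabolic
  · exact hasJordanBlock_mul t
  · exact hasJordanBlock_commutator t
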